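/- **Conventions.** Let $\mathtt{sFSet}$ be the category of the ordinals $[n]=\{1,\dots,n\}$, $n\ge 0$, and all maps. A (strict, nonunital) *operadic category* is a category $\mathtt O$ with a cardinality functor $|-|:\mathtt O\to\mathtt{sFSet}$ and, for every $R\in\mathtt O$ and $i\in|R|$, a fiber functor $\mathrm{Fib}_i:\mathtt O/R\to\mathtt O$, written $f\mapsto f^{-1}(i)$ on objects and $f\mapsto f_i$ on morphisms, such that: * $|f^{-1}(i)|=|f|^{-1}(i)$, and $|f_i|$ is the map of preimages induced by $|f|$; * if $f:S\to T$ is a morphism over $R$ from $g$ to $h$ (i.e. $g=hf$), then $f_i^{-1}(j)=f^{-1}(j)$ for $j\in|h^{-1}(i)|\subseteq|T|$; * for composable morphisms $S\xrightarrow{f}T\to Q$ over $R$ and $j$ in the cardinality of the $i$-th fiber of $Q\to R$, viewed as a subset of $|Q|$, $(f_i)_j=f_j$. It is *unital* with respect to a family $\{U_c\}_{c\in\pi_0(\mathtt O)}$ of local terminal objects, one in each connected component and all of cardinality $[1]$, if all fibers of identities belong to the family and $\mathrm{Fib}_1:\mathtt O/U_c\to\mathtt O$ is the domain functor for each $c$.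 Morphisms of unital operadic categories are the functors preserving cardinalities, fibers, induced maps between fibers, and the chosen local terminal objects. An operadic category is *perfect* if the fibers of its morphisms and the induced maps between them form a subcategory. Consider pairs $\mathtt Q=(\mathtt Q_L,\mathtt Q_R)$ consisting of an operadic structure $\mathtt Q_L$ on a category $\mathtt Q$ and an operadic structure $\mathtt Q_R$ on the opposite category. The cofibers of $h:S\to T$ are the fibers of $h^\dagger:T\to S$ in $\mathtt Q_R$, the bicardinality of $X$ is $(|X|_L,|X|_R)$, and $U^i_X$, resp. $C^j_X$, denote the fibers, resp. the cofibers, of $\mathbb 1_X$ (no index if there is only one). $\mathtt Q$ is *left bioperadic* if $\mathtt Q_L$ is perfect, with fiber subcategory $\mathtt Q_F$, all objects of $\mathtt Q_F$ have bicardinality $(a,1)$ for some $a$, and for every $h:S\to T$ in $\mathtt Q_F$ with fibers $F_1,\dots,F_n$ one has (1) $C_{F_i}=U^i_T$ for all $i$, and $C_S=C_T$. It is *right bioperadic* if $\mathtt Q_R$ is perfect, with fiber subcategory $\mathtt Q_C$, all objects of $\mathtt Q_C$ have bicardinality $(1,b)$ for some $b$, and for every $h:S\to T$ in $\mathtt Q_C$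 with cofibers $D_1,\dots,D_m$ one has (2) $U_{D_j}=C^j_S$ for all $j$, and $U_T=U_S$. It is *bioperadic* if it is left and right bioperadic and (1), (2) hold for all morphisms of $\mathtt Q$. Morphisms of bioperadic categories are the functors preserving cardinalities, fibers and induced maps of both structures. Let $\mathtt V$ be a symmetric monoidal category. An *$\mathtt O$-operad* is a collection $\{P(T)\}_{T\in\mathtt O}$ of objects of $\mathtt V$ with operations $\gamma_h:P(T)\otimes P(F_1)\otimes\cdots\otimes P(F_n)\to P(S)$ for all $h:S\to T$ with fibers $F_1,\dots,F_n$, associative in the sense that, with $P(f):=\bigotimes_iP(f^{-1}(i))$, for all $S\xrightarrow{f}T\xrightarrow{g}R$ the two composites $P(R)\otimes P(g)\otimes\bigotimes_{i\in|R|}P(f_i)\to P(S)$ given by $\gamma_{gf}\circ(\mathbb 1\otimes\bigotimes_i\gamma_{f_i})$ and $\gamma_f\circ(\gamma_g\otimes\mathbb 1)$ agree (no units are required). For bioperadic $\mathtt Q$, a *$\mathtt Q$-operad* is an operad over $\mathtt Q_F$. An *algebra* over an $\mathtt O$-operad $P$ is a collection $\{A_c\}_{c\in\pi_0(\mathtt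 O)}$ of objects of $\mathtt V$ with operations $a_T:P(T)\otimes\bigotimes_{i\in|T|}A_{\pi_0(U^i_T)}\to A_{\pi_0(T)}$, $T\in\mathtt O$, where $U^i_T$ is the $i$-th fiber of $\mathbb 1_T$; for every $h:S\to T$ with fibers $F_1,\dots,F_n$ it is required that the two composites out of $P(T)\otimes\bigotimes_i\big(P(F_i)\otimes\bigotimes_kA_{\pi_0(U^k_{F_i})}\big)$ given by $a_T\circ(\mathbb 1\otimes\bigotimes_ia_{F_i})$ and $a_S\circ(\gamma_h\otimes\mathbb 1)$ agree. An *algebra* over a $\mathtt Q$-operad is defined in the same way, with $\mathtt O$ replaced by $\mathtt Q_F$ and the target component $\pi_0(T)$ by $\pi_0(C_T)\in\pi_0(\mathtt Q_F)$. **Proposition.** For a unital operadic category $\mathtt O$ let its *bivariant envelope* be $\widehat{\mathtt O}=(\widehat{\mathtt O}_L,\widehat{\mathtt O}_R)$, where $\widehat{\mathtt O}_L=\mathtt O$ and $\widehat{\mathtt O}_R$ is the unary structure (all cardinalities are $[1]$) on the opposite category in which the cofiber of $h:S\to T$ is $U_{\pi_0(T)}$ and all induced maps between cofibers are identities. Then: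 1. each $\widehat{\mathtt O}$ is bioperadic, and $\mathtt O\mapsto\widehat{\mathtt O}$, $F\mapsto F$, is a faithful functor, injective on objects, from the category of unital operadic categories to the category of bioperadic categories $\mathtt Q=(\mathtt Q_L,\mathtt Q_R)$ with unital $\mathtt Q_L$; 2. for every unital $\mathtt O$ and every symmetric monoidal category $\mathtt V$, restriction of operads along the inclusion $\widehat{\mathtt O}_F\to\mathtt O$ is an isomorphism from the category of $\mathtt O$-operads to the category of $\widehat{\mathtt O}$-operads in $\mathtt V$; 3. for every $\mathtt O$-operad $P$ with corresponding $\widehat{\mathtt O}$-operad $\widehat P$, reindexing along $\pi_0(\widehat{\mathtt O}_F)\to\pi_0(\mathtt O)$, with the same structure operations, is an isomorphism from the category of $P$-algebras to the category of $\widehat P$-algebras. -/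

import Mathlib

open CategoryTheory MonoidalCategory Opposite

universe v u w v₁ u₁ v₂ u₂

namespace OpCat

set_option linter.checkUnivs false
set_option linter.unusedSectionVars false

/-! ## The skeletal category of finite sets -/

/-- Objects of the skeletal category of finite sets: `⟨n⟩` stands for the ordinal `[n]`. -/
structure SFSet : Type where
  size : ℕ

/-- Morphisms `[m] ⟶ [n]` are arbitrary maps. -/
instance : Category.{0} SFSet where
  Hom A B := Fin A.size → Fin B.size
  id _ := fun x => x
  comp f g := fun x => g (f x)

/-- The number of elements of the preimage of `i` under `φ : [m] → [n]`. -/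
def fiberSize {m n : ℕ} (φ : Fin m → Fin n) (i : Fin n) : ℕ :=
  (Finset.univ.filter fun x => φ x = i).card

/-- The order preserving inclusion of the preimage `φ⁻¹(i)`, identified with an ordinal. -/
def fiberIncl {m n : ℕ} (φ : Fin m → Fin n) (i : Fin n) : Fin (fiberSize φ i) → Fin m :=
  (Finset.univ.filter fun x => φ x = i).orderEmbOfFin rfl

/-! ## Operadic categories -/

/-- The set of connected components of a category. -/
abbrev Pi0 (C : Type u) [Category.{v} C] : Type u := CategoryTheory.ConnectedComponents C

/-- The connected component of an object. -/
abbrev pi0 {C : Type u} [Category.{v} C] (X : C) : Pi0 C :=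
  CategoryTheory.ConnectedComponents.mk X

lemma pi0_eq {C : Type u} [Category.{v} C] {X Y : C} (f : X ⟶ Y) : pi0 X = pi0 Y :=
  Quotient.sound (Zigzag.of_hom f)

/-- The data of an operadic category: cardinality functor, fiber functors
`Fib_i : C/R ⥤ C` for `i ∈ |R|`, and the equality `|f⁻¹(i)| = |f|⁻¹(i)` on objects. -/
structure FiberData (C : Type u) [Category.{v} C] where
  card : C ⥤ SFSet
  fib : ∀ {R : C}, Fin (card.obj R).size → Over R ⥤ C
  card_fib : ∀ {R : C} (i : Fin (card.obj R).size) (X : Over R),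
    (card.obj ((fib i).obj X)).size =
      fiberSize (n := (card.obj R).size) (card.map X.hom) i

namespace FiberData

variable {C : Type u} [Category.{v} C] (L : FiberData C)

/-- The number of elements of `|X|`. -/
abbrev size (X : C) : ℕ := (L.card.obj X).size

/-- The map of finite sets underlying a morphism. -/
abbrev cmap {S T : C} (f : S ⟶ T) : Fin (L.size S) → Fin (L.size T) := L.card.map f

/-- The inclusion `|X⁻¹(i)| = |X|⁻¹(i) ↪ |S|` for `X : S ⟶ R` and `i ∈ |R|`. -/
def pos {R : C} (i : Fin (L.size R)) (X : Over R) (k : Fin (L.size ((L.fib i).obj X))) :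
    Fin (L.size X.left) :=
  fiberIncl (L.cmap (T := R) X.hom) i (Fin.cast (L.card_fib i X) k)

end FiberData

/-- A (strict, nonunital) operadic category structure on the category `C`. -/
structure OperadicStr (C : Type u) [Category.{v} C] extends FiberData C where
  /-- `|f_i|` is the map `|g|⁻¹(i) → |h|⁻¹(i)` induced by `|f|`. -/
  card_fib_map : ∀ {R : C} (i : Fin (toFiberData.size R)) {X Y : Over R} (f : X ⟶ Y)
    (k : Fin (toFiberData.size ((fib i).obj X))),
    toFiberData.pos i Y (toFiberData.cmap ((fib i).map f) k) =
      toFiberData.cmap f.left (toFiberData.pos i X k)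
  /-- `f_i⁻¹(j) = f⁻¹(j)` for `j ∈ |h⁻¹(i)| ⊆ |T|`. -/
  fib_fib : ∀ {R : C} (i : Fin (toFiberData.size R)) {X Y : Over R} (f : X ⟶ Y)
    (j : Fin (toFiberData.size ((fib i).obj Y))),
    (fib j).obj (Over.mk ((fib i).map f)) =
      (fib (toFiberData.pos i Y j)).obj (Over.mk f.left)
  /-- `(f_i)_j = f_j` for `X ⟶ Y ⟶ Z` over `R` and `j ∈ |Z⁻¹(i)|`; source and target
  of both sides agree by `fib_fib`. -/
  fib_fib_map : ∀ {R : C} (i : Fin (toFiberData.size R)) {X Y Z : Over R} (f : X ⟶ Y)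
    (b : Y ⟶ Z) (j : Fin (toFiberData.size ((fib i).obj Z))),
    HEq
      ((fib j).map (Over.homMk ((fib i).map f) (by simp) :
        Over.mk ((fib i).map (f ≫ b)) ⟶ Over.mk ((fib i).map b)))
      ((fib (toFiberData.pos i Z j)).map (Over.homMk f.left (by simp) :
        Over.mk (f ≫ b).left ⟶ Over.mk b.left))

namespace OperadicStr

variable {C : Type u} [Category.{v} C] (L : OperadicStr C)

/-- The `i`-th fiber of `h`. -/
abbrev fibre {S T : C} (h : S ⟶ T) (i : Fin (L.size T)) : C := (L.fib i).obj (Over.mk h)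

/-- The map `f_i` between the `i`-th fibers of `f ≫ g` and `g`. -/
abbrev fibreMap {S T R : C} (f : S ⟶ T) (g : T ⟶ R) (i : Fin (L.size R)) :
    L.fibre (f ≫ g) i ⟶ L.fibre g i :=
  (L.fib i).map (Over.homMk f : Over.mk (f ≫ g) ⟶ Over.mk g)

/-- The inclusion `|h⁻¹(i)| ↪ |S|`. -/
abbrev incl {S T : C} (h : S ⟶ T) (i : Fin (L.size T)) (k : Fin (L.size (L.fibre h i))) :
    Fin (L.size S) :=
  L.pos i (Over.mk h) k

/-- The `i`-th fiber of the identity of `X`. -/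
abbrev idFibre (X : C) (i : Fin (L.size X)) : C := L.fibre (𝟙 X) i

lemma fibre_fibreMap {S T R : C} (f : S ⟶ T) (g : T ⟶ R) (i : Fin (L.size R))
    (k : Fin (L.size (L.fibre g i))) :
    L.fibre (L.fibreMap f g i) k = L.fibre f (L.incl g i k) :=
  L.fib_fib i (Over.homMk f : Over.mk (f ≫ g) ⟶ Over.mk g) k

lemma idFibre_fibre {S T : C} (h : S ⟶ T) (i : Fin (L.size T))
    (k : Fin (L.size (L.fibre h i))) :
    L.idFibre (L.fibre h i) k = L.idFibre S (L.incl h i k) := by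
  have := L.fib_fib i (𝟙 (Over.mk h)) k
  rw [CategoryTheory.Functor.map_id] at this
  exact this

/-! ### Unitality -/

/-- A family of local terminal objects of cardinality one, one in each connected component. -/
structure IsLocalTerminalFamily (U : Pi0 C → C) : Prop where
  mem : ∀ c, pi0 (U c) = c
  card_eq_one : ∀ c, L.size (U c) = 1
  terminal : ∀ X : C, Nonempty (Unique (X ⟶ U (pi0 X)))

/-- All fibers of identities belong to the family. -/
def LeftUnital (U : Pi0 C → C) : Prop :=
  ∀ (S : C) (i : Fin (L.size S)), ∃ c, L.idFibre S i = U c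

/-- The fiber functors on `C/U_c` are the domain functors. -/
def RightUnital (U : Pi0 C → C) : Prop :=
  ∀ c (i : Fin (L.size (U c))), L.fib i = Over.forget (U c)

/-- The operadic category is unital with respect to the family `U`. -/
structure IsUnital (U : Pi0 C → C) : Prop where
  family : L.IsLocalTerminalFamily U
  left : L.LeftUnital U
  right : L.RightUnital U

/-! ### Perfect operadic categories and the fiber subcategory -/

/-- `X` is a fiber of some morphism. -/
inductive IsFiber : C → Prop
  | mk {R : C} (i : Fin (L.size R)) (X : Over R) : IsFiber ((L.fib i).obj X)

/-- A morphism is induced if it is the map between fibers induced by some morphism. -/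
inductive IsInduced : ∀ {F G : C}, (F ⟶ G) → Prop
  | mk {R : C} (i : Fin (L.size R)) {X Y : Over R} (f : X ⟶ Y) : IsInduced ((L.fib i).map f)

/-- Fibers and induced morphisms form a subcategory. (Identities of fibers are always induced.) -/
def Perfect : Prop :=
  ∀ {F G H : C} (f : F ⟶ G) (g : G ⟶ H), L.IsInduced f → L.IsInduced g → L.IsInduced (f ≫ g)

variable {L}

lemma IsFiber.id_induced {X : C} (h : L.IsFiber X) : L.IsInduced (𝟙 X) := by
  cases h with
  | mk i X => rw [← (L.fib i).map_id]; exact IsInduced.mk i _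

/-- The fiber subcategory of a perfect operadic category. -/
structure FiberCat (hL : L.Perfect) where
  obj : C
  isFiber : L.IsFiber obj

instance (hL : L.Perfect) : Category (FiberCat hL) where
  Hom X Y := {f : X.obj ⟶ Y.obj // L.IsInduced f}
  id X := ⟨𝟙 X.obj, X.isFiber.id_induced⟩
  comp f g := ⟨f.1 ≫ g.1, hL f.1 g.1 f.2 g.2⟩

/-- The inclusion of the fiber subcategory. -/
def fiberInclusion (hL : L.Perfect) : FiberCat hL ⥤ C where
  obj X := X.obj
  map f := f.1

lemma fiberCat_heq {hL : L.Perfect} {X Y X' Y' : FiberCat hL} (hX : X = X') (hY : Y = Y')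
    (f : X ⟶ Y) (g : X' ⟶ Y') (h : HEq f.1 g.1) : HEq f g := by
  subst hX hY
  exact heq_of_eq (Subtype.ext (eq_of_heq h))

lemma FiberCat.ext' {hL : L.Perfect} {X Y : FiberCat hL} (h : X.obj = Y.obj) : X = Y := by
  cases X; cases Y; cases h; rfl

/-- The fiber functors restricted to the fiber subcategory. -/
def fiberFib (hL : L.Perfect) {R : FiberCat hL} (i : Fin (L.size R.obj)) :
    Over R ⥤ FiberCat hL where
  obj X := ⟨(L.fib i).obj ((Over.post (fiberInclusion hL)).obj X), .mk i _⟩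
  map f := ⟨(L.fib i).map ((Over.post (fiberInclusion hL)).map f), .mk i _⟩
  map_id X := Subtype.ext (by
    rw [CategoryTheory.Functor.map_id]; exact (L.fib i).map_id _)
  map_comp f g := Subtype.ext (by
    rw [CategoryTheory.Functor.map_comp]; exact (L.fib i).map_comp _ _)

/-- The fiber subcategory as an operadic subcategory. -/
def fiberStr (hL : L.Perfect) : OperadicStr (FiberCat hL) where
  card := fiberInclusion hL ⋙ L.card
  fib i := fiberFib hL i
  card_fib i X := L.card_fib i ((Over.post (fiberInclusion hL)).obj X)
  card_fib_map i _ _ f k := L.card_fib_map i ((Over.post (fiberInclusion hL)).map f) k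
  fib_fib i _ _ f j := FiberCat.ext' (L.fib_fib i ((Over.post (fiberInclusion hL)).map f) j)
  fib_fib_map i _ _ _ f b j := fiberCat_heq
    (FiberCat.ext' (L.fib_fib i ((Over.post (fiberInclusion hL)).map (f ≫ b)) j))
    (FiberCat.ext' (L.fib_fib i ((Over.post (fiberInclusion hL)).map b) j)) _ _
    (L.fib_fib_map i ((Over.post (fiberInclusion hL)).map f)
      ((Over.post (fiberInclusion hL)).map b) j)

end OperadicStr

/-! ### The unary structure of an idempotent endofunctor -/

lemma fiberSize_one (φ : Fin 1 → Fin 1) (i : Fin 1) : fiberSize φ i = 1 := by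
  have : (Finset.univ.filter fun x => φ x = i) = Finset.univ :=
    Finset.filter_true_of_mem fun _ _ => Subsingleton.elim _ _
  rw [fiberSize, this]
  rfl

/-- The unary operadic category with `r S ▹ S ⟶ T` and induced maps `r h`, for an
idempotent endofunctor `r`. -/
def unaryStr {C : Type u} [Category.{v} C] (r : C ⥤ C) (hr : r ⋙ r = r) : OperadicStr C where
  card := (Functor.const C).obj ⟨1⟩
  fib _ := Over.forget _ ⋙ r
  card_fib i _ := (fiberSize_one _ i).symm
  card_fib_map _ _ _ _ _ := Subsingleton.elim (α := Fin 1) _ _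
  fib_fib _ X _ _ _ := Functor.congr_obj hr X.left
  fib_fib_map _ _ _ _ f _ _ := by
    have h := Functor.congr_hom hr f.left
    simp only [Functor.comp_map] at h
    refine (heq_of_eq h).trans ?_
    simp

/-! ## Finite tensor products in a symmetric monoidal category -/

section Tensor

variable {V : Type w} [Category.{v₁} V] [MonoidalCategory V]

/-- The tensor product of the `X a`, where `a` runs through a list. -/
def tens {ι : Type*} (X : ι → V) : List ι → V
  | [] => 𝟙_ V
  | a :: l => X a ⊗ tens X l

/-- The tensor product of a family of morphisms. -/
def tensMap {ι : Type*} {X Y : ι → V} (f : ∀ a, X a ⟶ Y a) : ∀ l, tens X l ⟶ tens Y l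
  | [] => 𝟙 _
  | a :: l => f a ⊗ₘ tensMap f l

lemma tensMap_id {ι : Type*} (X : ι → V) (l : List ι) :
    tensMap (fun a => 𝟙 (X a)) l = 𝟙 (tens X l) := by
  induction l with
  | nil => rfl
  | cons a l ih => simp [tensMap, ih, tens]

lemma tensMap_comp {ι : Type*} {X Y Z : ι → V} (f : ∀ a, X a ⟶ Y a) (g : ∀ a, Y a ⟶ Z a)
    (l : List ι) : tensMap (fun a => f a ≫ g a) l = tensMap f l ≫ tensMap g l := by
  induction l with
  | nil => exact (Category.id_comp _).symm
  | cons a l ih =>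
    simp only [tensMap, ih]
    exact (tensorHom_comp_tensorHom _ _ _ _).symm

/-- Reindexing along a map. -/
def tensReindex {ι κ : Type*} (X : κ → V) (e : ι → κ) :
    ∀ l : List ι, tens (fun a => X (e a)) l ⟶ tens X (l.map e)
  | [] => 𝟙 _
  | a :: l => X (e a) ◁ tensReindex X e l

/-- The associativity isomorphism for concatenated lists. -/
def tensAppend {ι : Type*} (X : ι → V) (l' : List ι) :
    ∀ l : List ι, tens X l ⊗ tens X l' ⟶ tens X (l ++ l')
  | [] => (λ_ _).hom
  | a :: l => (α_ _ _ _).hom ≫ X a ◁ tensAppend X l' l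

/-- The associativity isomorphism for iterated tensor products. -/
def tensFlatten {ι κ : Type*} (X : κ → V) (f : ι → List κ) :
    ∀ l : List ι, tens (fun a => tens X (f a)) l ⟶ tens X (l.flatMap f)
  | [] => 𝟙 _
  | a :: l => tens X (f a) ◁ tensFlatten X f l ≫ tensAppend X (l.flatMap f) (f a)

/-- A presentation of a rearrangement of a list as a composite of adjacent transpositions. -/
inductive Rearrangement {ι : Type*} : List ι → List ι → Type _
  | nil : Rearrangement [] []
  | cons (a : ι) {l l' : List ι} : Rearrangement l l' → Rearrangement (a :: l) (a :: l')
  | swap (a b : ι) (l : List ι) : Rearrangement (a :: b :: l) (b :: a :: l)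
  | trans {l l' l'' : List ι} :
      Rearrangement l l' → Rearrangement l' l'' → Rearrangement l l''

/-- Lists that are permutations of each other admit a rearrangement. -/
lemma Rearrangement.exists_of_perm {ι : Type*} {l l' : List ι} (h : l.Perm l') :
    Nonempty (Rearrangement l l') := by
  induction h with
  | nil => exact ⟨.nil⟩
  | cons a _ ih => exact ih.map (.cons a)
  | swap a b l => exact ⟨.swap b a l⟩
  | trans _ _ ih ih' => exact ih.elim fun p => ih'.map p.trans

variable [SymmetricCategory V]

/-- The symmetry isomorphism of tensor products realizing a rearrangement. -/
def tensPerm {ι : Type*} (X : ι → V) :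
    ∀ {l l' : List ι}, Rearrangement l l' → (tens X l ⟶ tens X l')
  | _, _, .nil => 𝟙 _
  | _, _, .cons a p => X a ◁ tensPerm X p
  | _, _, .swap a b l =>
      (α_ (X a) (X b) (tens X l)).inv ≫ (β_ (X a) (X b)).hom ▷ tens X l ≫
        (α_ (X b) (X a) (tens X l)).hom
  | _, _, .trans p q => tensPerm X p ≫ tensPerm X q

/-- The shuffle isomorphism `(⨂ X a) ⊗ (⨂ Y a) ≅ ⨂ (X a ⊗ Y a)`. -/
def tensShuffle {ι : Type*} (X Y : ι → V) :
    ∀ l : List ι, tens X l ⊗ tens Y l ⟶ tens (fun a => X a ⊗ Y a) l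
  | [] => (λ_ _).hom
  | a :: l => tensorμ (X a) (tens X l) (Y a) (tens Y l) ≫ (X a ⊗ Y a) ◁ tensShuffle X Y l

/-- The tensor product `X 0 ⊗ ⋯ ⊗ X (n - 1)`. -/
abbrev bigTensor {n : ℕ} (X : Fin n → V) : V := tens X (List.finRange n)

/-- The concatenation of the lists `e i 0, …, e i (k i - 1)` for `i = 0, …, n - 1`. -/
def blocks {n m : ℕ} {k : Fin n → ℕ} (e : ∀ i, Fin (k i) → Fin m) : List (Fin m) :=
  (List.finRange n).flatMap fun i => (List.finRange (k i)).map (e i)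

/-- The canonical isomorphism `⨂ᵢ ⨂ₖ X i k ≅ ⨂ⱼ Y j` for a bijection `(i, k) ↦ e i k = j` such
that `X i k = Y j`. -/
def regroup {n m : ℕ} {k : Fin n → ℕ} (X : ∀ i, Fin (k i) → V) (Y : Fin m → V)
    (e : ∀ i, Fin (k i) → Fin m) (h : ∀ i a, X i a = Y (e i a))
    (p : Rearrangement (blocks e) (List.finRange m)) :
    bigTensor (fun i => bigTensor (X i)) ⟶ bigTensor Y :=
  tensMap (fun i => tensMap (fun a => eqToHom (h i a)) _ ≫ tensReindex Y (e i) _) _ ≫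
    tensFlatten Y _ _ ≫ tensPerm Y p

end Tensor

/-! ## Operads -/

section Operads

variable {C : Type u} [Category.{v} C]

lemma OperadicStr.cmap_incl (L : OperadicStr C) {S T : C} (h : S ⟶ T) (i : Fin (L.size T))
    (k : Fin (L.size (L.fibre h i))) : L.cmap h (L.incl h i k) = i :=
  (Finset.mem_filter.1 (Finset.orderEmbOfFin_mem
    (Finset.univ.filter fun x => L.cmap h x = i) rfl (Fin.cast (L.card_fib i (Over.mk h)) k))).2

lemma OperadicStr.incl_injective (L : OperadicStr C) {S T : C} (h : S ⟶ T)
    (i : Fin (L.size T)) : Function.Injective (L.incl h i) := fun _ _ e =>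
  Fin.cast_injective (L.card_fib i (Over.mk h)) ((Finset.orderEmbOfFin
    (Finset.univ.filter fun x => L.cmap h x = i) rfl).injective e)

lemma OperadicStr.exists_incl (L : OperadicStr C) {S T : C} (h : S ⟶ T)
    (x : Fin (L.size S)) : ∃ k, L.incl h (L.cmap h x) k = x := by
  have hx : x ∈ Set.range ((Finset.univ.filter fun y => L.cmap h y = L.cmap h x).orderEmbOfFin
      rfl) := by
    rw [Finset.range_orderEmbOfFin]; simp
  obtain ⟨k, hk⟩ := hx
  exact ⟨Fin.cast (L.card_fib (L.cmap h x) (Over.mk h)).symm k, hk⟩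

/-- The preimages of the elements of `|T|` exhaust `|S|`: the list of the positions of the fibers
of `h` is a rearrangement of `|S|`. -/
lemma OperadicStr.blocks_perm (L : OperadicStr C) {S T : C} (h : S ⟶ T) :
    (blocks fun i => L.incl h i).Perm (List.finRange (L.size S)) := by
  rw [List.perm_ext_iff_of_nodup ?_ (List.nodup_finRange _)]
  · intro x
    simp only [blocks, List.mem_flatMap, List.mem_map, List.mem_finRange, true_and, iff_true]
    exact ⟨_, L.exists_incl h x⟩
  · rw [blocks, List.nodup_flatMap]
    refine ⟨fun i _ => (List.nodup_finRange _).map (L.incl_injective h i),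
      (List.nodup_finRange _).imp fun {i j} hij => ?_⟩
    simp only [Function.onFun, List.disjoint_left, List.mem_map, List.mem_finRange, true_and]
    rintro _ ⟨a, rfl⟩ ⟨b, hb⟩
    apply hij
    rw [← L.cmap_incl h i a, ← hb, L.cmap_incl]

/-- A (nonunital) operad over an operadic category with values in `V`. -/
structure Operad (L : OperadicStr C) (V : Type w) [Category.{v₁} V] [MonoidalCategory V]
    [SymmetricCategory V] where
  obj : C → V
  /-- `γ_h : P(T) ⊗ P(F₁) ⊗ ⋯ ⊗ P(Fₙ) ⟶ P(S)` -/
  γ : ∀ {S T : C} (h : S ⟶ T), obj T ⊗ bigTensor (fun i => obj (L.fibre h i)) ⟶ obj S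
  /-- Associativity: both ways
  `P(R) ⊗ P(g) ⊗ P(f₁) ⊗ ⋯ ⊗ P(f_a) ⟶ P(S)` agree, where `P(f) = ⨂ᵢ P(f⁻¹(i))`. -/
  assoc : ∀ {S T R : C} (f : S ⟶ T) (g : T ⟶ R)
    (p : Rearrangement (blocks fun i => L.incl g i) (List.finRange (L.size T))),
    obj R ◁ (tensShuffle (fun i => obj (L.fibre g i))
          (fun i => bigTensor fun k => obj (L.fibre (L.fibreMap f g i) k)) _ ≫
        tensMap (fun i => γ (L.fibreMap f g i)) _) ≫ γ (f ≫ g) =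
      (α_ _ _ _).inv ≫ γ g ▷ _ ≫
        obj T ◁ regroup (fun i k => obj (L.fibre (L.fibreMap f g i) k))
          (fun j => obj (L.fibre f j)) (fun i => L.incl g i)
          (fun i k => congrArg obj (L.fibre_fibreMap f g i k)) p ≫ γ f

variable {L : OperadicStr C} {V : Type w} [Category.{v₁} V] [MonoidalCategory V]
  [SymmetricCategory V]

/-- A morphism of operads. -/
@[ext]
structure Operad.Hom (P Q : Operad L V) where
  app : ∀ T, P.obj T ⟶ Q.obj T
  comm : ∀ {S T : C} (h : S ⟶ T),
    P.γ h ≫ app S = (app T ⊗ₘ tensMap (fun i => app (L.fibre h i)) _) ≫ Q.γ h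

instance : Category (Operad L V) where
  Hom := Operad.Hom
  id P := ⟨fun _ => 𝟙 _, fun _ => by simp [tensMap_id]⟩
  comp φ ψ := ⟨fun T => φ.app T ≫ ψ.app T, fun h => by
    rw [← Category.assoc, φ.comm, Category.assoc, ψ.comm, ← Category.assoc, tensMap_comp,
      ← tensorHom_comp_tensorHom]⟩
  id_comp _ := Operad.Hom.ext (by funext; simp)
  comp_id _ := Operad.Hom.ext (by funext; simp)
  assoc _ _ _ := Operad.Hom.ext (by funext; simp)

/-- The restriction of an operad to the fiber subcategory. For a left dioperadic `Q`, a `Q`-operad is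
an operad over the operadic category `Q_F`. -/
def restrictOperads (hL : L.Perfect) : Operad L V ⥤ Operad (OperadicStr.fiberStr hL) V where
  obj P :=
    { obj := fun X => P.obj X.obj
      γ := fun h => P.γ h.1
      assoc := fun f g p => P.assoc f.1 g.1 p }
  map φ := ⟨fun X => φ.app X.obj, fun h => φ.comm h.1⟩

end Operads

/-! ## Algebras -/

section Algebras

/-- An assignment of sources and targets: every object `X` has a list `src X` of sources,
indexed by `|X|`, and one target `tgt X`, subject to the equalities that are needed to
formulate the associativity of an algebra. -/
structure Boundary {C : Type u} [Category.{v} C] (L : OperadicStr C) (K : Type u₁) where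
  src : ∀ X : C, Fin (L.size X) → K
  tgt : C → K
  tgt_fibre : ∀ {S T : C} (h : S ⟶ T) (i : Fin (L.size T)), tgt (L.fibre h i) = src T i
  tgt_eq : ∀ {S T : C}, (S ⟶ T) → tgt T = tgt S
  src_fibre : ∀ {S T : C} (h : S ⟶ T) (i : Fin (L.size T)) (k : Fin (L.size (L.fibre h i))),
    src (L.fibre h i) k = src S (L.incl h i k)

variable {C : Type u} [Category.{v} C] {L : OperadicStr C} {K : Type u₁}
  {V : Type w} [Category.{v₁} V] [MonoidalCategory V] [SymmetricCategory V]

/-- An algebra over the operad `P`, with the sources and targets given by `B`. -/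
structure Algebra (B : Boundary L K) (P : Operad L V) where
  obj : K → V
  /-- `a_X : P(X) ⊗ A_{s(X)} ⟶ A_{t(X)}` -/
  act : ∀ X : C, P.obj X ⊗ bigTensor (fun i => obj (B.src X i)) ⟶ obj (B.tgt X)
  /-- Both ways
  `P(T) ⊗ P(F₁) ⊗ ⋯ ⊗ P(Fₙ) ⊗ A_{s(F₁)} ⊗ ⋯ ⊗ A_{s(Fₙ)} ⟶ A_{t(S)}` agree. -/
  assoc : ∀ {S T : C} (h : S ⟶ T)
    (p : Rearrangement (blocks fun i => L.incl h i) (List.finRange (L.size S))),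
    P.obj T ◁ (tensShuffle (fun i => P.obj (L.fibre h i))
          (fun i => bigTensor fun k => obj (B.src (L.fibre h i) k)) _ ≫
        tensMap (fun i => act (L.fibre h i) ≫ eqToHom (congrArg obj (B.tgt_fibre h i))) _) ≫
        act T ≫ eqToHom (congrArg obj (B.tgt_eq h)) =
      (α_ _ _ _).inv ≫ P.γ h ▷ _ ≫
        P.obj S ◁ regroup (fun i k => obj (B.src (L.fibre h i) k)) (fun j => obj (B.src S j))
          (fun i => L.incl h i) (fun i k => congrArg obj (B.src_fibre h i k)) p ≫ act S

/-- A morphism of algebras over a fixed operad. -/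
@[ext]
structure Algebra.Hom {B : Boundary L K} {P : Operad L V} (A A' : Algebra B P) where
  app : ∀ c, A.obj c ⟶ A'.obj c
  comm : ∀ X : C, A.act X ≫ app (B.tgt X) =
    P.obj X ◁ tensMap (fun i => app (B.src X i)) _ ≫ A'.act X

instance {B : Boundary L K} {P : Operad L V} : Category (Algebra B P) where
  Hom := Algebra.Hom
  id A := ⟨fun _ => 𝟙 _, fun _ => by simp [tensMap_id]⟩
  comp φ ψ := ⟨fun c => φ.app c ≫ ψ.app c, fun X => by
    rw [← Category.assoc, φ.comm, Category.assoc, ψ.comm, ← Category.assoc, tensMap_comp,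
      whiskerLeft_comp]⟩
  id_comp _ := Algebra.Hom.ext (by funext; simp)
  comp_id _ := Algebra.Hom.ext (by funext; simp)
  assoc _ _ _ := Algebra.Hom.ext (by funext; simp)

/-- The classical sources and targets in an operadic category: the sources of `X` are the connected
components of the fibers of the identity of `X`, the target is the component of `X`. -/
def classicalBoundary (L : OperadicStr C) : Boundary L (Pi0 C) where
  src X i := pi0 (L.idFibre X i)
  tgt X := pi0 X
  tgt_fibre h i := pi0_eq ((L.fib i).map (Over.homMk h : Over.mk h ⟶ Over.mk (𝟙 _)))
  tgt_eq h := (pi0_eq h).symm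
  src_fibre h i k := congrArg pi0 (L.idFibre_fibre h i k)

end Algebras

/-! ## Pairs `Q = (Q_L, Q_R)` and bioperadic categories -/

/-- A category `Q` with an operadic structure `Q_L` on `Q` and an operadic structure `Q_R` on the
opposite category. -/
structure OperadicPair (C : Type u) [Category.{v} C] where
  L : OperadicStr C
  R : OperadicStr Cᵒᵖ

namespace OperadicPair

variable {C : Type u} [Category.{v} C] (Q : OperadicPair C)

/-- The `i`-th fiber of `h`. -/
abbrev fiber {S T : C} (h : S ⟶ T) (i : Fin (Q.L.size T)) : C := Q.L.fibre h i

/-- The `j`-th cofiber of `h`, i.e. the `j`-th fiber of the opposite of `h` in `Q_R`. -/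
abbrev cofiber {S T : C} (h : S ⟶ T) (j : Fin (Q.R.size (op S))) : C :=
  unop (Q.R.fibre h.op j)

/-- The bicardinality. -/
abbrev bicard (X : C) : ℕ × ℕ := (Q.L.size X, Q.R.size (op X))

/-- The equalities `C_{F_i} = U^i_T` for `h : S ⟶ T` with fibers `F_i`. -/
def FiberCondition {S T : C} (h : S ⟶ T) : Prop :=
  ∀ (i : Fin (Q.L.size T)) (j : Fin (Q.R.size (op (Q.fiber h i)))),
    Q.cofiber (𝟙 (Q.fiber h i)) j = Q.fiber (𝟙 T) i

/-- The equalities `U_{D_j} = C^j_S` for `h : S ⟶ T` with cofibers `D_j`. -/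
def CofiberCondition {S T : C} (h : S ⟶ T) : Prop :=
  ∀ (j : Fin (Q.R.size (op S))) (i : Fin (Q.L.size (Q.cofiber h j))),
    Q.fiber (𝟙 (Q.cofiber h j)) i = Q.cofiber (𝟙 S) j

/-- Left bioperadic: `Q_L` is perfect, objects of `Q_F` have bicardinality `(a, 1)`, and
`C_{F_i} = U^i_T` and `C_S = C_T` for morphisms `S ⟶ T` of `Q_F`. -/
structure IsLeftBioperadic : Prop where
  perfect : Q.L.Perfect
  bicard_eq : ∀ X : C, Q.L.IsFiber X → ∃ a, Q.bicard X = (a, 1)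
  fiberCondition : ∀ {S T : C} (h : S ⟶ T), Q.L.IsInduced h → Q.FiberCondition h
  target_eq : ∀ {S T : C} (h : S ⟶ T), Q.L.IsInduced h →
    ∀ (j : Fin (Q.R.size (op S))) (j' : Fin (Q.R.size (op T))),
      Q.cofiber (𝟙 S) j = Q.cofiber (𝟙 T) j'

/-- Right bioperadic: `Q_R` is perfect, objects of `Q_C` have bicardinality `(1, b)`, and
`U_{D_j} = C^j_S` and `U_T = U_S` for morphisms `S ⟶ T` of `Q_C`. -/
structure IsRightBioperadic : Prop where
  perfect : Q.R.Perfect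
  bicard_eq : ∀ X : C, Q.R.IsFiber (op X) → ∃ b, Q.bicard X = (1, b)
  cofiberCondition : ∀ {S T : C} (h : S ⟶ T), Q.R.IsInduced h.op → Q.CofiberCondition h
  source_eq : ∀ {S T : C} (h : S ⟶ T), Q.R.IsInduced h.op →
    ∀ (i : Fin (Q.L.size T)) (i' : Fin (Q.L.size S)),
      Q.fiber (𝟙 T) i = Q.fiber (𝟙 S) i'

/-- Bioperadic: left and right bioperadic, with `C_{F_i} = U^i_T` and `U_{D_j} = C^j_S` for all
morphisms of `Q`. -/
structure IsBioperadic : Prop where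
  left : Q.IsLeftBioperadic
  right : Q.IsRightBioperadic
  fiberCondition : ∀ {S T : C} (h : S ⟶ T), Q.FiberCondition h
  cofiberCondition : ∀ {S T : C} (h : S ⟶ T), Q.CofiberCondition h

variable {Q}

/-- The index of the only cofiber of the identity of an object of `Q_F`. -/
def IsBioperadic.index (hQ : Q.IsBioperadic) {X : C} (hX : Q.L.IsFiber X) :
    Fin (Q.R.size (op X)) :=
  Fin.cast (by
    obtain ⟨a, ha⟩ := hQ.left.bicard_eq X hX
    exact (congrArg Prod.snd ha).symm) (0 : Fin 1)

/-- The cofiber of the identity of an object of `Q_F` belongs to `Q_F`. -/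
lemma IsBioperadic.cofiber_isFiber (hQ : Q.IsBioperadic) {X : C} (hX : Q.L.IsFiber X)
    (j : Fin (Q.R.size (op X))) : Q.L.IsFiber (Q.cofiber (𝟙 X) j) := by
  cases hX with
  | @mk R i Y =>
    have h := hQ.fiberCondition Y.hom i j
    change Q.cofiber (𝟙 (Q.fiber Y.hom i)) j = _ at h
    change Q.L.IsFiber (Q.cofiber (𝟙 (Q.fiber Y.hom i)) j)
    rw [h]
    exact .mk i _

/-- The cofiber `C_X` of the identity of an object of `Q_F`, as an object of `Q_F`. -/
def IsBioperadic.targetObj (hQ : Q.IsBioperadic)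
    (X : OperadicStr.FiberCat hQ.left.perfect) : OperadicStr.FiberCat hQ.left.perfect :=
  ⟨Q.cofiber (𝟙 X.obj) (hQ.index X.isFiber), hQ.cofiber_isFiber X.isFiber _⟩

/-- The sources and targets in the fiber subcategory of a bioperadic category: the connected
components in `Q_F` of the fibers, resp. of the cofiber, of the identity. -/
def IsBioperadic.boundary (hQ : Q.IsBioperadic) :
    Boundary (OperadicStr.fiberStr hQ.left.perfect)
      (Pi0 (OperadicStr.FiberCat hQ.left.perfect)) where
  src X i := pi0 ((OperadicStr.fiberStr hQ.left.perfect).idFibre X i)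
  tgt X := pi0 (hQ.targetObj X)
  tgt_fibre h i := congrArg pi0 (OperadicStr.FiberCat.ext' (hQ.fiberCondition h.1 i _))
  tgt_eq h := congrArg pi0
    (OperadicStr.FiberCat.ext' (hQ.left.target_eq h.1 h.2 _ _).symm)
  src_fibre h i k := congrArg pi0 ((OperadicStr.fiberStr hQ.left.perfect).idFibre_fibre h i k)

end OperadicPair

/-! ## Categories of operadic and of bioperadic categories -/

/-- A functor is operadic if it preserves cardinalities, fibers and the induced morphisms. -/
structure IsOperadicFunctor {C : Type u} [Category.{v} C] {D : Type u₁} [Category.{v₁} D]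
    (L : OperadicStr C) (L' : OperadicStr D) (F : C ⥤ D) : Prop where
  card_eq : F ⋙ L'.card = L.card
  fib_eq : ∀ {R : C} (i : Fin (L.size R)) (i' : Fin (L'.size (F.obj R))), i.val = i'.val →
    L.fib i ⋙ F = Over.post F ⋙ L'.fib i'

lemma IsOperadicFunctor.id {C : Type u} [Category.{v} C] (L : OperadicStr C) :
    IsOperadicFunctor L L (𝟭 C) where
  card_eq := rfl
  fib_eq i i' h := by
    obtain rfl : i = i' := Fin.ext h
    rfl

lemma IsOperadicFunctor.comp {C : Type u} [Category.{v} C] {D : Type u₁} [Category.{v₁} D]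
    {E : Type u₂} [Category.{v₂} E] {L : OperadicStr C} {L' : OperadicStr D}
    {L'' : OperadicStr E} {F : C ⥤ D} {G : D ⥤ E} (hF : IsOperadicFunctor L L' F)
    (hG : IsOperadicFunctor L' L'' G) : IsOperadicFunctor L L'' (F ⋙ G) where
  card_eq := by rw [Functor.assoc, hG.card_eq, hF.card_eq]
  fib_eq {R} i i' h := by
    have e : L.size R = L'.size (F.obj R) :=
      (congrArg SFSet.size (Functor.congr_obj hF.card_eq R)).symm
    rw [← Functor.assoc, hF.fib_eq i (Fin.cast e i) rfl, Functor.assoc,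
      hG.fib_eq (Fin.cast e i) i' h]
    rfl

/-- Unital operadic categories. -/
structure UnitalOperadicCat where
  carrier : Type u
  [category : Category.{v} carrier]
  str : OperadicStr carrier
  unit : Pi0 carrier → carrier
  isUnital : str.IsUnital unit

attribute [instance] UnitalOperadicCat.category

/-- Morphisms of unital operadic categories: operadic functors that preserve the chosen local
terminal objects. -/
@[ext]
structure UnitalOperadicCat.Hom (O O' : UnitalOperadicCat.{v, u}) where
  functor : O.carrier ⥤ O'.carrier
  isOperadic : IsOperadicFunctor O.str O'.str functor
  map_unit : ∀ c, functor.obj (O.unit c) = O'.unit (functor.mapConnectedComponents c)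

instance : Category UnitalOperadicCat.{v, u} where
  Hom := UnitalOperadicCat.Hom
  id O := ⟨𝟭 _, .id _, fun c => by induction c using Quotient.inductionOn; rfl⟩
  comp F G := ⟨F.functor ⋙ G.functor, F.isOperadic.comp G.isOperadic, fun c => by
    induction c using Quotient.inductionOn
    exact (congrArg _ (F.map_unit _)).trans (G.map_unit _)⟩

/-- Pairs `Q = (Q_L, Q_R)`, bundled with the underlying category. -/
structure OperadicPairCat where
  carrier : Type u
  [category : Category.{v} carrier]
  pair : OperadicPair carrier

attribute [instance] OperadicPairCat.category

/-- Morphisms of pairs: functors that are operadic for both structures. -/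
@[ext]
structure OperadicPairCat.Hom (Q Q' : OperadicPairCat.{v, u}) where
  functor : Q.carrier ⥤ Q'.carrier
  isOperadic_left : IsOperadicFunctor Q.pair.L Q'.pair.L functor
  isOperadic_right : IsOperadicFunctor Q.pair.R Q'.pair.R functor.op

instance : Category OperadicPairCat.{v, u} where
  Hom := OperadicPairCat.Hom
  id Q := ⟨𝟭 _, .id _, .id _⟩
  comp F G := ⟨F.functor ⋙ G.functor, F.isOperadic_left.comp G.isOperadic_left,
    F.isOperadic_right.comp G.isOperadic_right⟩

/-- Bioperadic categories `Q` for which `Q_L` is unital with respect to some family of chosen local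
terminal objects. -/
structure IsBioperadicWithUnitalLeft (Q : OperadicPairCat.{v, u}) : Prop where
  bioperadic : Q.pair.IsBioperadic
  unital : ∃ U : Pi0 Q.carrier → Q.carrier, Q.pair.L.IsUnital U

/-- The category of bioperadic categories `Q` with unital `Q_L`, as a full subcategory. -/
abbrev BioperadicCatWithUnitalLeft :=
  ObjectProperty.FullSubcategory
    (IsBioperadicWithUnitalLeft : ObjectProperty OperadicPairCat.{v, u})

/-! ## The bivariant envelope -/

section Envelope

/-- The endofunctor sending each object to the chosen object in its connected component, and each
morphism to an identity. -/
def componentFunctor {C : Type u} [Category.{v} C] (U : Pi0 C → C) : C ⥤ C where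
  obj X := U (pi0 X)
  map f := eqToHom (congrArg U (pi0_eq f))

lemma componentFunctor_idem {C : Type u} [Category.{v} C] (U : Pi0 C → C)
    (hU : ∀ c, pi0 (U c) = c) : componentFunctor U ⋙ componentFunctor U = componentFunctor U :=
  CategoryTheory.Functor.ext (fun _ => congrArg U (hU _)) fun _ _ _ => by
    simp only [componentFunctor, Functor.comp_map]
    exact ((congrArg _ (eqToHom_trans _ _)).trans (eqToHom_trans _ _)).symm

/-- The bivariant envelope: `Q_L` is the given unital operadic category, and the cofiber of
`h : S ⟶ T` is the chosen local terminal object in the connected component of `T`. -/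
def envelopePair (O : UnitalOperadicCat.{v, u}) : OperadicPair O.carrier where
  L := O.str
  R := unaryStr (componentFunctor O.unit).op
    (congrArg Functor.op (componentFunctor_idem O.unit O.isUnital.family.mem))

lemma componentFunctor_naturality {O O' : UnitalOperadicCat.{v, u}} (F : O ⟶ O') :
    componentFunctor O.unit ⋙ F.functor = F.functor ⋙ componentFunctor O'.unit :=
  CategoryTheory.Functor.ext (fun X => F.map_unit (pi0 X)) fun _ _ _ => by
    simp only [componentFunctor, Functor.comp_map, eqToHom_map]
    exact ((congrArg _ (eqToHom_trans _ _)).trans (eqToHom_trans _ _)).symm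

/-- The bivariant envelope as a functor. -/
def envelope : UnitalOperadicCat.{v, u} ⥤ OperadicPairCat.{v, u} where
  obj O := { carrier := O.carrier, pair := envelopePair O }
  map F :=
    { functor := F.functor
      isOperadic_left := F.isOperadic
      isOperadic_right :=
        { card_eq := rfl
          fib_eq := fun _ _ _ => by
            have h := congrArg Functor.op (componentFunctor_naturality F)
            change Over.forget _ ⋙ (componentFunctor _ ⋙ F.functor).op = _
            rw [h]
            rfl } }

section Restriction

variable (O : UnitalOperadicCat.{v, u}) (hQ : (envelope.obj O).pair.IsBioperadic)
  {V : Type w} [Category.{v₁} V] [MonoidalCategory V] [SymmetricCategory V]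

/-- In the envelope of `O`, the cofiber of the identity of `X` lies in the same connected component
of `O` as `X`. -/
lemma pi0_targetObj (X : OperadicStr.FiberCat hQ.left.perfect) :
    pi0 X.obj = pi0 (hQ.targetObj X).obj :=
  (O.isUnital.family.mem (pi0 X.obj)).symm

lemma restrictAlgebras_assoc_aux {n : ℕ} {p q p' q' q'' y y' y'' z : V} {x : Fin n → V}
    {a b c : Fin n → V} {l : List (Fin n)} (s : q ⟶ tens x l) (f : ∀ i, x i ⟶ a i)
    (e₁ : ∀ i, a i = b i) (e₂ : ∀ i, b i = c i) (e₃ : ∀ i, a i = c i)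
    (t : p ⊗ tens c l ⟶ y) (e₄ : y = y') (e₅ : y' = y'') (e₆ : y = z) (e₇ : z = y'')
    (r₁ : p ⊗ q ⟶ p') (r₂ : p' ⟶ q') (r₃ : q' ⟶ q'') (r₄ : q'' ⟶ z)
    (h : p ◁ (s ≫ tensMap (fun i => f i ≫ eqToHom (e₃ i)) l) ≫ t ≫ eqToHom e₆ =
      r₁ ≫ r₂ ≫ r₃ ≫ r₄) :
    p ◁ (s ≫ tensMap (fun i => (f i ≫ eqToHom (e₁ i)) ≫ eqToHom (e₂ i)) l) ≫
        (t ≫ eqToHom e₄) ≫ eqToHom e₅ =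
      r₁ ≫ r₂ ≫ r₃ ≫ r₄ ≫ eqToHom e₇ := by
  subst e₄ e₅ e₆
  simp only [eqToHom_refl, Category.comp_id, Category.assoc, eqToHom_trans] at h ⊢
  exact h

lemma eqToHom_family {K : Type*} {A A' : K → V} (φ : ∀ c, A c ⟶ A' c) {c c' : K} (h : c = c') :
    eqToHom (congrArg A h) ≫ φ c' = φ c ≫ eqToHom (congrArg A' h) := by
  subst h; simp

/-- The comparison of algebras: an algebra over an operad `P` over `O` is sent to the algebra over
the operad over the envelope corresponding to `P`, with the same components, indexed along
`π₀(Q_F) → π₀(O)`, and the same structure operations. -/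
def restrictAlgebras (P : Operad O.str V) :
    Algebra (classicalBoundary O.str) P ⥤
      Algebra hQ.boundary ((restrictOperads hQ.left.perfect).obj P) where
  obj A :=
    { obj := fun c => A.obj ((OperadicStr.fiberInclusion _).mapConnectedComponents c)
      act := fun X => A.act X.obj ≫ eqToHom (congrArg A.obj (pi0_targetObj O hQ X))
      assoc := fun h p => restrictAlgebras_assoc_aux _ _ _ _ _ _ _ _ _ _ _ _ _ _
        (A.assoc h.1 p) }
  map {A A'} φ :=
    { app := fun c => φ.app _
      comm := fun X => by
        have h := eqToHom_family φ.app (pi0_targetObj O hQ X)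
        refine (Category.assoc _ _ _).trans ((congrArg (A.act X.obj ≫ ·) h).trans ?_)
        refine (Category.assoc _ _ _).symm.trans ?_
        exact (congrArg (· ≫ _) (φ.comm X.obj)).trans (Category.assoc _ _ _) }

end Restriction

end Envelope

/-- A functor is an isomorphism of categories if it has a strict inverse. -/
def IsIsomorphismOfCategories {C : Type u} [Category.{v} C] {D : Type u₁} [Category.{v₁} D]
    (F : C ⥤ D) : Prop :=
  ∃ G : D ⥤ C, F ⋙ G = 𝟭 C ∧ G ⋙ F = 𝟭 D

end OpCat

/-! The fiber subcategory of a unital operadic category is the whole category. Every `X` has a map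
to the chosen object `U_c` of its component, and `Fib` over `U_c` is the domain functor. So `X` is
the fiber of that map, and every `f : X ⟶ Y`, read as a morphism over `U_c`, induces itself
(`isFiber`, `isInduced`). This gives perfectness and makes restriction of operads invertible.

The bioperadic equalities reduce to comparing components. A fiber `F_i` of `h : S ⟶ T` maps to
`U^i_T`, which is itself a chosen object, so `C_{F_i} = U_{π₀(F_i)} = U^i_T` (`unit_pi0_fibre`).
Dually, the identity of `U_c` has fiber `U_c` (`idFibre_unit`), and the ends of a morphism share a
component.

The envelope keeps the functors, hence faithfulness. It keeps `O` as its left structure and records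
`U_c` as the cofiber of the identity of any object of `c`, hence injectivity on objects.

For algebras, `C_X` lies in the component of `X`, so the two notions of target differ only by the
bijection between `π₀` of the fiber subcategory and `π₀(O)`. What remains is cancelling the
resulting `eqToHom`s (`Algebra.functor_eq_id`). -/

namespace OpCat

/-! ### Fibers and induced maps in a unital operadic category -/

namespace OperadicStr

variable {C : Type u} [Category.{v} C] {L : OperadicStr C}

namespace IsUnital

variable {U : Pi0 C → C}

/-- Right unitality: the fiber functor over the chosen object is the domain functor, so `f`, viewed
over `U (pi0 Y)`, is its own induced map. -/
lemma isInduced (hU : L.IsUnital U) {X Y : C} (f : X ⟶ Y) : L.IsInduced f := by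
  obtain ⟨t⟩ := hU.family.terminal Y
  let i : Fin (L.size (U (pi0 Y))) := Fin.cast (hU.family.card_eq_one _).symm 0
  -- The equality of functors is consumed by substitution for a variable `G`. Taking `G` to be the
  -- domain functor afterwards, `G.map` of the morphism over `U (pi0 Y)` is `f` by definition.
  have key : ∀ G : Over (U (pi0 Y)) ⥤ C, L.fib i = G →
      ∀ {A B : Over (U (pi0 Y))} (a : A ⟶ B), L.IsInduced (G.map a) := by
    rintro _ rfl A B a
    exact .mk i a
  exact key _ (hU.right _ i)
    (Over.homMk f : Over.mk (f ≫ t.default) ⟶ Over.mk t.default)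

lemma isFiber (hU : L.IsUnital U) (X : C) : L.IsFiber X := by
  obtain ⟨t⟩ := hU.family.terminal X
  let i : Fin (L.size (U (pi0 X))) := Fin.cast (hU.family.card_eq_one _).symm 0
  have key : ∀ G : Over (U (pi0 X)) ⥤ C, L.fib i = G → ∀ A, L.IsFiber (G.obj A) := by
    rintro _ rfl A
    exact .mk i A
  exact key _ (hU.right _ i) (Over.mk t.default)

lemma perfect (hU : L.IsUnital U) : L.Perfect := fun _ _ _ _ => hU.isInduced _

/-- Viewing `h` as a morphism over `T` from `h` to the identity gives a map from its fiber to that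
of the identity. The latter is a chosen object by left unitality, hence the chosen object of this
common component. In the envelope this is the equality `C_{F_i} = U^i_T`. -/
lemma unit_pi0_fibre (hU : L.IsUnital U) {S T : C} (h : S ⟶ T) (i : Fin (L.size T)) :
    U (pi0 (L.fibre h i)) = L.idFibre T i := by
  obtain ⟨c, hc⟩ := hU.left T i
  have e : pi0 (L.fibre h i) = pi0 (L.idFibre T i) :=
    pi0_eq ((L.fib i).map (Over.homMk h : Over.mk h ⟶ Over.mk (𝟙 _)))
  rw [e, hc, hU.family.mem]

lemma idFibre_unit (hU : L.IsUnital U) (c : Pi0 C) (i : Fin (L.size (U c))) :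
    L.idFibre (U c) i = U c :=
  Functor.congr_obj (hU.right c i) _

end IsUnital

/-- When all objects and all morphisms are fibers, the fiber subcategory is everything. -/
def toFiberCat (hL : L.Perfect) (ho : ∀ X, L.IsFiber X)
    (hm : ∀ {X Y : C} (f : X ⟶ Y), L.IsInduced f) : C ⥤ FiberCat hL where
  obj X := ⟨X, ho X⟩
  map f := ⟨f, hm f⟩

end OperadicStr

/-! ### The bivariant envelope is bioperadic -/

lemma componentFunctor_op_idem {C : Type u} [Category.{v} C] {U : Pi0 C → C}
    (hU : ∀ c, pi0 (U c) = c) :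
    (componentFunctor U).op ⋙ (componentFunctor U).op = (componentFunctor U).op :=
  congrArg Functor.op (componentFunctor_idem U hU)

/-- Induced maps between cofibers are values of `componentFunctor`, which sends all morphisms to
identifications of chosen objects. This description makes the closure under composition and the
conditions on `Q_C` immediate. -/
lemma unaryStr_isInduced_iff {C : Type u} [Category.{v} C] {U : Pi0 C → C}
    (hr : (componentFunctor U).op ⋙ (componentFunctor U).op = (componentFunctor U).op)
    {F G : Cᵒᵖ} {f : F ⟶ G} :
    (unaryStr (componentFunctor U).op hr).IsInduced f ↔
      ∃ (c : Pi0 C) (_ : F = op (U c)) (e : F = G), f = eqToHom e := by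
  constructor
  · rintro ⟨i, a⟩
    rename_i R X Y
    have e : U (pi0 Y.left.unop) = U (pi0 X.left.unop) := congrArg U (pi0_eq a.left.unop)
    refine ⟨pi0 X.left.unop, rfl, congrArg op e.symm, ?_⟩
    exact eqToHom_op e
  · rintro ⟨c, rfl, rfl, rfl⟩
    -- With a representative `X` of `c`, the object `U c` is by definition the cofiber of the
    -- identity of `X`.
    induction c using Quotient.inductionOn with
    | h X =>
      exact (OperadicStr.IsFiber.mk (L := unaryStr (componentFunctor U).op hr) (R := op X) (0 : Fin 1)
        (Over.mk (𝟙 (op X)))).id_induced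

lemma envelopePair_isBioperadic (O : UnitalOperadicCat.{v, u}) :
    (envelopePair O).IsBioperadic := by
  have hU := O.isUnital
  have hr := componentFunctor_op_idem hU.family.mem
  have fc : ∀ {S T : O.carrier} (h : S ⟶ T), (envelopePair O).FiberCondition h :=
    fun h i _ => hU.unit_pi0_fibre h i
  have cc : ∀ {S T : O.carrier} (h : S ⟶ T), (envelopePair O).CofiberCondition h :=
    fun h _ i => (hU.idFibre_unit _ i).trans (congrArg O.unit (pi0_eq h).symm)
  refine ⟨⟨hU.perfect, fun X _ => ⟨_, rfl⟩, fun h _ => fc h,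
    fun h _ _ _ => congrArg O.unit (pi0_eq h)⟩, ⟨?_, ?_, fun h _ => cc h, ?_⟩, fc, cc⟩
  · intro F G H f g hf hg
    obtain ⟨c, hc, rfl, rfl⟩ := (unaryStr_isInduced_iff hr).1 hf
    obtain ⟨-, -, rfl, rfl⟩ := (unaryStr_isInduced_iff hr).1 hg
    exact (unaryStr_isInduced_iff hr).2 ⟨c, hc, rfl, by simp⟩
  · intro X hX
    -- Passing to the identity, which is induced because `X` is a cofiber, shows that `X` is a
    -- chosen object and so has left cardinality one.
    obtain ⟨c, hc, -⟩ := (unaryStr_isInduced_iff hr).1 hX.id_induced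
    obtain rfl : X = O.unit c := congrArg unop hc
    exact ⟨1, congrArg (·, 1) (hU.family.card_eq_one c)⟩
  · intro S T h hh i i'
    -- Both ends of an induced map are the same chosen object, whose identity has that object as its
    -- fiber.
    obtain ⟨c, hc, e, -⟩ := (unaryStr_isInduced_iff hr).1 hh
    obtain rfl : T = O.unit c := congrArg unop hc
    obtain rfl : O.unit c = S := congrArg unop e
    exact (hU.idFibre_unit c i).trans (hU.idFibre_unit c i').symm

lemma envelope_isBioperadicWithUnitalLeft (O : UnitalOperadicCat.{v, u}) :
    IsBioperadicWithUnitalLeft (envelope.obj O) :=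
  ⟨envelopePair_isBioperadic O, O.unit, O.isUnital⟩

/-! ### Faithfulness and injectivity on objects -/

lemma envelope_map_injective {O O' : UnitalOperadicCat.{v, u}} {F G : O ⟶ O'}
    (h : envelope.map F = envelope.map G) : F = G :=
  UnitalOperadicCat.Hom.ext (congrArg OperadicPairCat.Hom.functor h)

/-- The family is visible in the unary structure: `U c` is the cofiber of the identity of any object
of `c`. -/
lemma unaryStr_componentFunctor_injective {C : Type u} [Category.{v} C] {U U' : Pi0 C → C}
    (hr : (componentFunctor U).op ⋙ (componentFunctor U).op = (componentFunctor U).op)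
    (hr' : (componentFunctor U').op ⋙ (componentFunctor U').op = (componentFunctor U').op)
    (h : unaryStr (componentFunctor U).op hr = unaryStr (componentFunctor U').op hr') :
    U = U' := by
  funext c
  induction c using Quotient.inductionOn with
  | h X =>
    -- The type of indices depends on the structure, so indices are compared by value while the
    -- structures are still variables.
    have key : ∀ L L' : OperadicStr Cᵒᵖ, L = L' → ∀ (i : Fin (L.size (op X)))
        (i' : Fin (L'.size (op X))), i.val = i'.val →
          (L.idFibre (op X) i).unop = (L'.idFibre (op X) i').unop := by
      rintro L _ rfl i i' hi
      rw [Fin.ext hi]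
    exact key _ _ h (0 : Fin 1) (0 : Fin 1) rfl

lemma envelope_obj_injective :
    Function.Injective (envelope.obj : UnitalOperadicCat.{v, u} → OperadicPairCat.{v, u}) := by
  rintro ⟨C, L, U, hU⟩ ⟨C', L', U', hU'⟩ h
  simp only [envelope, OperadicPairCat.mk.injEq] at h
  -- Carriers, category structures and pairs are identified in this order, because each
  -- heterogeneous equality becomes an equality only after the preceding substitution.
  obtain ⟨rfl, h⟩ := h
  obtain ⟨h₁, h₂⟩ := h
  obtain rfl := eq_of_heq h₁
  have h₃ := eq_of_heq h₂
  obtain rfl : L = L' := congrArg OperadicPair.L h₃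
  obtain rfl : U = U' := unaryStr_componentFunctor_injective
    (componentFunctor_op_idem hU.family.mem) (componentFunctor_op_idem hU'.family.mem)
    (congrArg OperadicPair.R h₃)
  rfl

/-! ### Operads over the fiber subcategory -/

section Operads

variable {C : Type u} [Category.{v} C] {L : OperadicStr C} {V : Type w} [Category.{v₁} V]
  [MonoidalCategory V] [SymmetricCategory V]

/-- The extension of an operad over the fiber subcategory, when the latter is everything. -/
def extendOperads (hL : L.Perfect) (ho : ∀ X, L.IsFiber X)
    (hm : ∀ {X Y : C} (f : X ⟶ Y), L.IsInduced f) :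
    Operad (OperadicStr.fiberStr hL) V ⥤ Operad L V where
  obj P :=
    { obj := fun X => P.obj ⟨X, ho X⟩
      γ := fun {S T} h => P.γ (S := ⟨S, ho S⟩) (T := ⟨T, ho T⟩) ⟨h, hm h⟩
      assoc := fun {S T R} f g p =>
        P.assoc (S := ⟨S, ho S⟩) (T := ⟨T, ho T⟩) (R := ⟨R, ho R⟩) ⟨f, hm f⟩ ⟨g, hm g⟩ p }
  map φ := ⟨fun X => φ.app ⟨X, ho X⟩, fun {S T} h =>
    φ.comm (S := ⟨S, ho S⟩) (T := ⟨T, ho T⟩) ⟨h, hm h⟩⟩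

/-- Objects and morphisms of `FiberCat hL` are those of `C` paired with proofs, so both round trips
are identities by eta and proof irrelevance. -/
lemma restrictOperads_isIsomorphism (hL : L.Perfect) (ho : ∀ X, L.IsFiber X)
    (hm : ∀ {X Y : C} (f : X ⟶ Y), L.IsInduced f) :
    IsIsomorphismOfCategories (restrictOperads hL : Operad L V ⥤ _) :=
  ⟨extendOperads hL ho hm, rfl, rfl⟩

end Operads

/-! ### Equality of algebras and of functors between their categories -/

/-- The compatibility of actions in a round trip between the two kinds of algebras. Each direction
adds one identification of targets and the comparison adds a third, closing a loop, while the
identifications of sources are reflexive. -/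
lemma comp_eqToHom_eq_tensMap_eqToHom_comp {V : Type w} [Category.{v₁} V]
    [MonoidalCategory V] {p a b c : V} {n : ℕ} {x : Fin n → V} (hx : ∀ i, x i = x i)
    (t : p ⊗ bigTensor x ⟶ a) (e₁ : a = b) (e₂ : b = c) (e₃ : c = a) :
    ((t ≫ eqToHom e₁) ≫ eqToHom e₂) ≫ eqToHom e₃ =
      p ◁ tensMap (fun i => eqToHom (hx i)) _ ≫ t := by
  subst e₁ e₂
  simp [tensMap_id]

section Algebras

variable {C : Type u} [Category.{v} C] {L : OperadicStr C} {K : Type u₁}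
  {V : Type w} [Category.{v₁} V] [MonoidalCategory V] [SymmetricCategory V]
  {B : Boundary L K} {P : Operad L V}

lemma Algebra.ext_of_eqToHom {A A' : Algebra B P} (h : ∀ c, A.obj c = A'.obj c)
    (hact : ∀ X, A.act X ≫ eqToHom (h (B.tgt X)) =
      P.obj X ◁ tensMap (fun i => eqToHom (h (B.src X i))) _ ≫ A'.act X) : A = A' := by
  obtain ⟨obj, act, _⟩ := A
  obtain ⟨obj', act', _⟩ := A'
  obtain rfl : obj = obj' := funext h
  obtain rfl : act = act' := by
    funext X
    simpa [tensMap_id] using hact X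
  rfl

lemma Algebra.comp_app {A A' A'' : Algebra B P} (φ : A ⟶ A') (ψ : A' ⟶ A'') (c : K) :
    Algebra.Hom.app (φ ≫ ψ) c = φ.app c ≫ ψ.app c := rfl

lemma Algebra.eqToHom_app {A A' : Algebra B P} (h : A = A') (c : K) :
    Algebra.Hom.app (eqToHom h) c = eqToHom (congrArg (fun A : Algebra B P => A.obj c) h) := by
  subst h; rfl

/-- An endofunctor of a category of algebras that only reindexes along the identity is the
identity. -/
lemma Algebra.functor_eq_id (F : Algebra B P ⥤ Algebra B P) {e : K → K} (he : ∀ c, e c = c)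
    (hobj : ∀ A c, (F.obj A).obj c = A.obj (e c))
    (hact : ∀ A X, (F.obj A).act X ≫ eqToHom ((hobj A _).trans (congrArg A.obj (he _))) =
      P.obj X ◁ tensMap (fun i => eqToHom ((hobj A _).trans
        (congrArg A.obj (he (B.src X i))))) _ ≫ A.act X)
    (hmap : ∀ {A A' : Algebra B P} (φ : A ⟶ A') c,
      HEq (Algebra.Hom.app (F.map φ) c) (Algebra.Hom.app φ (e c))) : F = 𝟭 _ := by
  -- In the applications `e` is the identity only propositionally, on classes of a quotient. Keeping
  -- it a variable allows it to be substituted here, after which `hobj` and `hact` have the form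
  -- needed for extensionality.
  obtain rfl : e = id := funext he
  refine CategoryTheory.Functor.ext (fun A => Algebra.ext_of_eqToHom (hobj A) (hact A))
    fun A A' φ => Algebra.Hom.ext (funext fun c => ?_)
  rw [Algebra.comp_app, Algebra.comp_app, Algebra.eqToHom_app, Algebra.eqToHom_app]
  exact (conj_eqToHom_iff_heq _ _ (hobj A c) (hobj A' c)).2 (hmap φ c)

end Algebras

/-! ### Algebras over an operad and over its counterpart on the envelope -/

section Restriction

variable (O : UnitalOperadicCat.{v, u}) (hQ : (envelope.obj O).pair.IsBioperadic)
  {V : Type w} [Category.{v₁} V] [MonoidalCategory V] [SymmetricCategory V]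

/-- The strict inverse of the inclusion of the fiber subcategory of the envelope. -/
abbrev toEnvelopeFiberCat : O.carrier ⥤ OperadicStr.FiberCat hQ.left.perfect :=
  OperadicStr.toFiberCat (L := O.str) hQ.left.perfect O.isUnital.isFiber O.isUnital.isInduced

/-- `C_X` and `X` are connected in `O`. The inverse of the inclusion carries the connecting zigzag
into the fiber subcategory, where components are taken with respect to induced maps only. -/
lemma pi0_toEnvelopeFiberCat (X : OperadicStr.FiberCat hQ.left.perfect) :
    pi0 (hQ.targetObj X) = pi0 X :=
  congrArg (toEnvelopeFiberCat O hQ).mapConnectedComponents (pi0_targetObj O hQ X).symm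

/-- The inverse of the comparison of algebras. -/
def extendAlgebras (P : Operad O.str V) :
    Algebra hQ.boundary ((restrictOperads hQ.left.perfect).obj P) ⥤
      Algebra (classicalBoundary O.str) P where
  obj A :=
    { obj := fun c => A.obj ((toEnvelopeFiberCat O hQ).mapConnectedComponents c)
      act := fun X => A.act ((toEnvelopeFiberCat O hQ).obj X) ≫
        eqToHom (congrArg A.obj (pi0_toEnvelopeFiberCat O hQ _))
      -- As for restriction, the actions change only by identifications of targets, which the
      -- auxiliary lemma absorbs.
      assoc := fun h p => restrictAlgebras_assoc_aux _ _ _ _ _ _ _ _ _ _ _ _ _ _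
        (A.assoc ((toEnvelopeFiberCat O hQ).map h) p) }
  map {A A'} φ :=
    { app := fun c => φ.app _
      comm := fun X => by
        -- The identification of targets slides past the family `φ`, leaving the compatibility of
        -- `φ` with the uncorrected action.
        have h := eqToHom_family φ.app
          (pi0_toEnvelopeFiberCat O hQ ((toEnvelopeFiberCat O hQ).obj X))
        refine (Category.assoc _ _ _).trans
          ((congrArg (A.act ((toEnvelopeFiberCat O hQ).obj X) ≫ ·) h).trans ?_)
        refine (Category.assoc _ _ _).symm.trans ?_
        exact (congrArg (· ≫ _) (φ.comm ((toEnvelopeFiberCat O hQ).obj X))).trans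
          (Category.assoc _ _ _) }

/-- Each round trip reindexes along a self-map of the set of components that fixes every class `pi0
X` by definition. Sources have this form, so they match on the nose; for the index map itself a
representative must be chosen, hence the quotient inductions. -/
lemma restrictAlgebras_isIsomorphism (P : Operad O.str V) :
    IsIsomorphismOfCategories (restrictAlgebras O hQ P) := by
  refine ⟨extendAlgebras O hQ P, ?_, ?_⟩
  · exact Algebra.functor_eq_id _
      (e := fun c => (OperadicStr.fiberInclusion _).mapConnectedComponents
        ((toEnvelopeFiberCat O hQ).mapConnectedComponents c))
      (fun c => by induction c using Quotient.inductionOn; rfl) (fun _ _ => rfl)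
      (fun _ _ => comp_eqToHom_eq_tensMap_eqToHom_comp _ _ _ _ _) (fun _ _ => HEq.rfl)
  · exact Algebra.functor_eq_id _
      (e := fun c => (toEnvelopeFiberCat O hQ).mapConnectedComponents
        ((OperadicStr.fiberInclusion _).mapConnectedComponents c))
      (fun c => by induction c using Quotient.inductionOn; rfl) (fun _ _ => rfl)
      (fun _ _ => comp_eqToHom_eq_tensMap_eqToHom_comp _ _ _ _ _) (fun _ _ => HEq.rfl)

end Restriction

end OpCat

theorem mainTheorem1 :
    ∃ h : ∀ O : OpCat.UnitalOperadicCat.{v, u},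
        OpCat.IsBioperadicWithUnitalLeft (OpCat.envelope.obj O),
      (ObjectProperty.lift _ OpCat.envelope.{v, u} h :
          OpCat.UnitalOperadicCat.{v, u} ⥤ OpCat.BioperadicCatWithUnitalLeft.{v, u}).Faithful ∧
      Function.Injective (ObjectProperty.lift _ OpCat.envelope.{v, u} h :
          OpCat.UnitalOperadicCat.{v, u} ⥤ OpCat.BioperadicCatWithUnitalLeft.{v, u}).obj ∧
      ∀ (O : OpCat.UnitalOperadicCat.{v, u}) (V : Type w) [Category.{v₁} V]
        [MonoidalCategory V] [SymmetricCategory V],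
        OpCat.IsIsomorphismOfCategories
            (OpCat.restrictOperads (h O).bioperadic.left.perfect :
              OpCat.Operad O.str V ⥤
                OpCat.Operad (OpCat.OperadicStr.fiberStr (h O).bioperadic.left.perfect) V) ∧
          ∀ P : OpCat.Operad O.str V,
            OpCat.IsIsomorphismOfCategories
              (OpCat.restrictAlgebras O (h O).bioperadic P) := by
  refine ⟨OpCat.envelope_isBioperadicWithUnitalLeft,
    ⟨fun h => OpCat.envelope_map_injective (congrArg (·.hom) h)⟩,
    fun _ _ h => OpCat.envelope_obj_injective (congrArg (·.obj) h), fun O V _ _ _ =>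
      ⟨OpCat.restrictOperads_isIsomorphism _ O.isUnital.isFiber O.isUnital.isInduced,
        OpCat.restrictAlgebras_isIsomorphism O _⟩⟩
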